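/- All spaces are real, $X'$ denotes the (bounded) dual of $X$, and for an ultrafilter $\mathscr U$ on $\mathbb N$ the ultraproduct $(X_n)_{\mathscr U}$ of normed spaces is the space of bounded sequences $(x_n)\in\prod_n X_n$, with the supremum norm, modulo the sequences with $\lim_{\mathscr U}\|x_n\|=0$; the class of $(x_n)$ is $(x_n)_{\mathscr U}$, and $X_{\mathscr U}$ is the ultraproduct with $X_n=X$ for all $n$. A bounded linear functional $\varphi$ on $(X_n)_{\mathscr U}$ is called accessible if there are maps $f_n:X_n\to\mathbb R$ (not necessarily linear) such that $\varphi((x_n)_{\mathscr U})=\lim_{\mathscr U(n)} f_n(x_n)$ for every bounded sequence $(x_n)$. We write $(X_n')_{\mathscr U}=(X_n)_{\mathscr U}'$ if the canonical map sending $(g_n)_{\mathscr U}$ to the functional $(x_n)_{\mathscr U}\mapsto\lim_{\mathscr U(n)} g_n(x_n)$ is an isometric isomorphism of $(X_n')_{\mathscr U}$ onto $(X_n)_{\mathscr U}'$. A Banach space $X$ is super-reflexive if every Banach space finitely representable in $X$ is reflexive. (1) Let $\mathscr U$ be a free ultrafilter on $\mathbb N$ and let $(X_n)$ be a sequence of finite-dimensional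 normed spaces. If every bounded linear functional on $(X_n)_{\mathscr U}$ is accessible, then $(X_n')_{\mathscr U}=(X_n)_{\mathscr U}'$. (2) Let $\mathscr U$ be a countably incomplete ultrafilter on $\mathbb N$ and let $X$ be a Banach space with a (finite or infinite) Schauder basis. If every bounded linear functional on $X_{\mathscr U}$ is accessible, then $X$ is super-reflexive and $(X_{\mathscr U})'=(X')_{\mathscr U}$. -/

import Mathlib

open Filter Topology
open scoped ENNReal

universe u v w

noncomputable section

/-- The space `c₀^𝒰(I, X_i)` of bounded families whose norms tend to zero along `𝒰`. -/
def nullFamilies {ι : Type w} (𝒰 : Ultrafilter ι) (X : ι → Type u)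
    [∀ i, NormedAddCommGroup (X i)] [∀ i, NormedSpace ℝ (X i)] : Submodule ℝ (lp X ∞) where
  carrier := {x | Tendsto (fun i => ‖x i‖) (𝒰 : Filter ι) (𝓝 0)}
  zero_mem' := by simp
  add_mem' := by
    intro x y hx hy
    have h : Tendsto (fun i => ‖x i‖ + ‖y i‖) (𝒰 : Filter ι) (𝓝 0) := by
      simpa using hx.add hy
    exact squeeze_zero (fun i => norm_nonneg _) (fun i => norm_add_le (x i) (y i)) h
  smul_mem' := by
    intro c x hx
    have h : Tendsto (fun i => ‖c‖ * ‖x i‖) (𝒰 : Filter ι) (𝓝 0) := by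
      simpa using hx.const_mul ‖c‖
    simpa [norm_smul] using h

/-- The Banach space ultraproduct `(X_i)_𝒰`: the bounded families (with the supremum norm)
modulo the families that tend to zero along `𝒰`, with the quotient norm. -/
abbrev BanachUltraproduct {ι : Type w} (𝒰 : Ultrafilter ι) (X : ι → Type u)
    [∀ i, NormedAddCommGroup (X i)] [∀ i, NormedSpace ℝ (X i)] : Type (max u w) :=
  lp X ∞ ⧸ nullFamilies 𝒰 X

/-- The class `(x_i)_𝒰` of a bounded family `(x_i)`. -/
def ultraClass {ι : Type w} (𝒰 : Ultrafilter ι) {X : ι → Type u}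
    [∀ i, NormedAddCommGroup (X i)] [∀ i, NormedSpace ℝ (X i)] (x : lp X ∞) :
    BanachUltraproduct 𝒰 X :=
  Submodule.Quotient.mk x

/-- A functional `φ` on `(X_i)_𝒰` is accessible if there are arbitrary maps `f_i : X_i → ℝ` with
`φ((x_i)_𝒰) = (f_i(x_i))_𝒰` for all bounded families `(x_i)`. The ultrapower `ℝ_𝒰` is identified
with `ℝ` through the limit along `𝒰`. -/
def IsAccessible {ι : Type w} {𝒰 : Ultrafilter ι} {X : ι → Type u}
    [∀ i, NormedAddCommGroup (X i)] [∀ i, NormedSpace ℝ (X i)]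
    (φ : BanachUltraproduct 𝒰 X → ℝ) : Prop :=
  ∃ f : ∀ i, X i → ℝ, ∀ x : lp X ∞,
    Tendsto (fun i => f i (x i)) (𝒰 : Filter ι) (𝓝 (φ (ultraClass 𝒰 x)))

/-- `(X_i')_𝒰 = ((X_i)_𝒰)'`: the canonical map, sending `(g_i)_𝒰` to the functional
`(x_i)_𝒰 ↦ lim_𝒰 g_i(x_i)`, is an isometric isomorphism of `(X_i')_𝒰` onto the dual of
`(X_i)_𝒰`. (The limit condition determines `e`.) -/
def UltraproductDualEq {ι : Type w} (𝒰 : Ultrafilter ι) (X : ι → Type u)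
    [∀ i, NormedAddCommGroup (X i)] [∀ i, NormedSpace ℝ (X i)] : Prop :=
  ∃ e : BanachUltraproduct 𝒰 (fun i => StrongDual ℝ (X i)) ≃ₗᵢ[ℝ]
      StrongDual ℝ (BanachUltraproduct 𝒰 X),
    ∀ (g : lp (fun i => StrongDual ℝ (X i)) ∞) (x : lp X ∞),
      Tendsto (fun i => g i (x i)) (𝒰 : Filter ι)
        (𝓝 (e (ultraClass 𝒰 g) (ultraClass 𝒰 x)))

/-- `Y` is finitely representable in `X`: for every `ε > 0`, each finite-dimensional subspace of
`Y` is `(1 + ε)`-isomorphic to a subspace of `X`. -/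
def FinitelyRepresentable (Y : Type v) [NormedAddCommGroup Y] [NormedSpace ℝ Y]
    (X : Type u) [NormedAddCommGroup X] [NormedSpace ℝ X] : Prop :=
  ∀ E : Submodule ℝ Y, FiniteDimensional ℝ E → ∀ ε : ℝ, 0 < ε →
    ∃ T : E →ₗ[ℝ] X, ∀ y : E, ‖y‖ ≤ ‖T y‖ ∧ ‖T y‖ ≤ (1 + ε) * ‖y‖

/-- `Y` is reflexive: the canonical embedding into the bidual is onto. -/
def IsReflexiveSpace (Y : Type v) [NormedAddCommGroup Y] [NormedSpace ℝ Y] : Prop :=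
  Function.Surjective (NormedSpace.inclusionInDoubleDual ℝ Y)

/-- `X` is super-reflexive: every Banach space (in the universe `v`) that is finitely
representable in `X` is reflexive. -/
def IsSuperReflexive (X : Type u) [NormedAddCommGroup X] [NormedSpace ℝ X] : Prop :=
  ∀ (Y : Type v) [NormedAddCommGroup Y] [NormedSpace ℝ Y] [CompleteSpace Y],
    FinitelyRepresentable Y X → IsReflexiveSpace Y

end

/-! Accessibility forces the ultraproduct Y to be reflexive. By James, a non-reflexive complete
space carries bounded vectors x_j and functionals f_k of norm at most 1 with f_k(x_j) > θ > 0 for k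
≤ j and f_k(x_j) = 0 for j < k (`nonempty_jamesSequence_of_not_surjective`). In Y, let φ be a weak-*
limit of the f_k along a free ultrafilter, so φ(x_j) = 0 for all j. If φ and the f_k are accessible,
these relations can be read off coordinatewise, and overspill gives a diagonal element z_n =
x_{N(n)}(n), N → ∞ along 𝒰, with f_k(z) ≥ θ for all k. Then φ(z) ≥ θ, but also φ(z) ≤ θ/2
(`isEmpty_jamesSequence_of_isAccessible`).

Reflexivity of Y gives the duality: functionals induced by bounded families separate points of Y, so
their closed range is the whole dual. For super-reflexivity, a James sequence in a space finitely
representable in X is copied into the ultrapower, where none exists. -/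

/-! ### James sequences in non-reflexive spaces -/

section James

variable {Y : Type*} [SeminormedAddCommGroup Y] [NormedSpace ℝ Y]

/-- A one-sided bound suffices because the ball is symmetric. Dividing by ‖x‖ + δ covers vectors of
seminorm zero. -/
theorem StrongDual.norm_le_of_forall_apply_le {g : StrongDual ℝ Y} {u : ℝ}
    (h : ∀ x, ‖x‖ ≤ 1 → g x ≤ u) : ‖g‖ ≤ u := by
  have hu : 0 ≤ u := by simpa using h 0 (by simp)
  have key : ∀ x, g x ≤ u * ‖x‖ := by
    intro x
    have hδ : ∀ δ : ℝ, 0 < δ → g x ≤ u * (‖x‖ + δ) := by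
      intro δ hδ
      have hpos : 0 < ‖x‖ + δ := by positivity
      have := h ((‖x‖ + δ)⁻¹ • x) (by
        rw [norm_smul, norm_inv, Real.norm_of_nonneg hpos.le, inv_mul_le_iff₀ hpos]
        linarith)
      rw [map_smul, smul_eq_mul, inv_mul_le_iff₀ hpos] at this
      linarith
    have hlim : Tendsto (fun δ : ℝ => u * (‖x‖ + δ)) (𝓝[>] 0) (𝓝 (u * (‖x‖ + 0))) :=
      ((continuous_const.mul (continuous_const.add continuous_id)).tendsto 0).mono_left
        nhdsWithin_le_nhds
    simpa using ge_of_tendsto hlim (eventually_mem_nhdsWithin.mono fun δ h => hδ δ h)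
  refine g.opNorm_le_bound hu fun x => ?_
  rw [Real.norm_eq_abs, abs_le]
  have := key (-x)
  rw [map_neg, norm_neg] at this
  exact ⟨by linarith, key x⟩

/-- A bidual element at distance more than `d` from `Y` is bounded below by `d` at some functional
of the dual ball that vanishes at finitely many prescribed points. -/
theorem exists_dual_vanishing_of_lt_norm_sub
    {F : StrongDual ℝ (StrongDual ℝ Y)} {d : ℝ}
    (hF : ∀ y, d < ‖F - NormedSpace.inclusionInDoubleDual ℝ Y y‖) (s : Finset Y) :
    ∃ f : StrongDual ℝ Y, ‖f‖ ≤ 1 ∧ d < F f ∧ ∀ x ∈ s, f x = 0 := by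
  by_contra! hcon
  let L : s → StrongDual ℝ Y →ₗ[ℝ] ℝ := fun x =>
    (NormedSpace.inclusionInDoubleDual ℝ Y (x : Y)).toLinearMap
  let M : Submodule ℝ (StrongDual ℝ Y) := ⨅ i, LinearMap.ker (L i)
  have hM : ∀ f ∈ M, ∀ x ∈ s, f x = 0 := fun f hf x hx => by
    have := (Submodule.mem_iInf _).1 hf ⟨x, hx⟩
    simpa [L] using this
  -- F - G vanishes on M, hence is evaluation at a combination of the points of s; so ‖G‖ ≤ d would
  -- put F within d of Y.
  obtain ⟨G, hGF, hG⟩ := exists_extension_norm_eq M (F.comp M.subtypeL)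
  have hle : ‖G‖ ≤ d := by
    rw [hG]
    refine StrongDual.norm_le_of_forall_apply_le fun f hf => ?_
    by_contra! hlt
    obtain ⟨x, hx, hne⟩ := hcon f hf hlt
    exact hne (hM f f.2 x hx)
  have hspan : (F - G).toLinearMap ∈ Submodule.span ℝ (Set.range L) := by
    refine mem_span_of_iInf_ker_le_ker fun f hf => ?_
    have := hGF ⟨f, hf⟩
    simp only [ContinuousLinearMap.comp_apply, Submodule.subtypeL_apply] at this
    simp [this]
  obtain ⟨c, hc⟩ := (Submodule.mem_span_range_iff_exists_fun ℝ).1 hspan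
  refine (hF (∑ i, c i • (i : Y))).not_ge ?_
  have : F - NormedSpace.inclusionInDoubleDual ℝ Y (∑ i, c i • (i : Y)) = G := by
    ext f
    have := LinearMap.congr_fun hc f
    simp [L] at this
    simp [this]
  rw [this]
  exact hle

/-- Every bidual element is approximated, on finitely many functionals, by a vector of no larger
norm. -/
theorem exists_norm_le_forall_lt_apply (F : StrongDual ℝ (StrongDual ℝ Y))
    (s : Finset (StrongDual ℝ Y)) {ε : ℝ} (hε : 0 < ε) :
    ∃ x : Y, ‖x‖ ≤ ‖F‖ ∧ ∀ f ∈ s, F f - ε < f x := by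
  classical
  let T : Y →L[ℝ] (s → ℝ) := ContinuousLinearMap.pi fun f => (f : StrongDual ℝ Y)
  let K : Set (s → ℝ) := T '' Metric.closedBall 0 ‖F‖
  have hK : Convex ℝ K := (convex_closedBall _ _).linear_image T.toLinearMap
  -- Helly's argument: a separating functional on the finite product pulls back to g with F g > ‖F‖
  -- ‖g‖.
  have hmem : (fun f : s => F f) ∈ closure K := by
    by_contra hnot
    obtain ⟨L, u, hLu, huL⟩ := geometric_hahn_banach_closed_point hK.closure isClosed_closure hnot
    let g : StrongDual ℝ Y := L.comp T
    have hLsum : ∀ v : s → ℝ, L v = ∑ f, v f * L (Pi.single f 1) := by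
      intro v
      conv_lhs => rw [pi_eq_sum_univ' v]
      simp
    have hg : g = ∑ f : s, L (Pi.single f 1) • (f : StrongDual ℝ Y) := by
      ext x
      have := hLsum (T x)
      simpa [g, T, mul_comm] using this
    have hFg : F g = L fun f : s => F f := by
      rw [hg, hLsum]
      simp [mul_comm]
    have hgu : ‖‖F‖ • g‖ ≤ u := by
      refine StrongDual.norm_le_of_forall_apply_le fun x hx => ?_
      have := hLu (T (‖F‖ • x)) (subset_closure ⟨_, by
        rw [mem_closedBall_zero_iff, norm_smul, Real.norm_of_nonneg (norm_nonneg F)]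
        exact mul_le_of_le_one_right (norm_nonneg F) hx, rfl⟩)
      simpa [g] using this.le
    have := (le_abs_self _).trans (F.le_opNorm g)
    rw [norm_smul, Real.norm_of_nonneg (norm_nonneg F)] at hgu
    linarith
  obtain ⟨_, ⟨x, hx, rfl⟩, hdist⟩ := Metric.mem_closure_iff.1 hmem ε hε
  refine ⟨x, by simpa using hx, fun f hf => ?_⟩
  have h := (dist_le_pi_dist (fun f : s => F f) (T x) ⟨f, hf⟩).trans_lt hdist
  have := (abs_lt.1 h).2
  have e : T x ⟨f, hf⟩ = f x := rfl
  linarith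

/-- A James sequence in `Y`: bounded vectors `x j` and bounded functionals `f k` with
`f k (x j) ≥ θ` for `k ≤ j` and `f k (x j) = 0` for `j < k`. -/
structure JamesSequence (Y : Type*) [SeminormedAddCommGroup Y] [NormedSpace ℝ Y] where
  vec : ℕ → Y
  fn : ℕ → StrongDual ℝ Y
  bound : ℝ
  norm_vec_le : ∀ j, ‖vec j‖ ≤ bound
  norm_fn_le : ∀ k, ‖fn k‖ ≤ 1
  gap : ℝ
  gap_pos : 0 < gap
  gap_lt : ∀ k j, k ≤ j → gap < fn k (vec j)
  eq_zero : ∀ k j, j < k → fn k (vec j) = 0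

/-- A complete space that is not reflexive contains a James sequence. -/
theorem nonempty_jamesSequence_of_not_surjective [CompleteSpace Y]
    (h : ¬ Function.Surjective (NormedSpace.inclusionInDoubleDual ℝ Y)) :
    Nonempty (JamesSequence Y) := by
  classical
  let J := NormedSpace.inclusionInDoubleDual ℝ Y
  obtain ⟨F, hF⟩ := not_forall.1 h
  have hclosed : IsClosed (Set.range J) :=
    ((NormedSpace.inclusionInDoubleDualLi (E := Y) ℝ).isometry.isUniformInducing.isComplete_range
      ).isClosed
  have hpos : 0 < Metric.infDist F (Set.range J) :=
    (hclosed.notMem_iff_infDist_pos (Set.range_nonempty J)).1 hF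
  obtain ⟨d, hd0, hd⟩ := exists_between hpos
  have hFd : ∀ y, d < ‖F - J y‖ := fun y =>
    (hd.trans_le (Metric.infDist_le_dist_of_mem (Set.mem_range_self y))).trans_eq
      (dist_eq_norm F (J y))
  -- Each new functional kills all earlier vectors; each new vector imitates F up to d / 2 on all
  -- functionals so far, where F exceeds d.
  obtain ⟨a, ha, har⟩ := exists_seq_of_forall_finset_exists
    (fun p : Y × StrongDual ℝ Y => ‖p.1‖ ≤ ‖F‖ ∧ ‖p.2‖ ≤ 1 ∧ d < F p.2 ∧ d / 2 < p.2 p.1)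
    (fun p q => q.2 p.1 = 0 ∧ d / 2 < p.2 q.1) (by
      intro s hs
      obtain ⟨f, hf1, hfd, hf0⟩ := exists_dual_vanishing_of_lt_norm_sub hFd (s.image Prod.fst)
      obtain ⟨x, hx, hxf⟩ :=
        exists_norm_le_forall_lt_apply F (insert f (s.image Prod.snd)) (half_pos hd0)
      refine ⟨(x, f), ⟨hx, hf1, hfd, ?_⟩, fun p hp => ⟨?_, ?_⟩⟩
      · have := hxf f (by simp)
        dsimp only
        linarith
      · exact hf0 _ (Finset.mem_image_of_mem _ hp)
      · have := hxf p.2 (Finset.mem_insert_of_mem (Finset.mem_image_of_mem _ hp))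
        have := (hs p hp).2.2.1
        dsimp only
        linarith)
  exact ⟨{
    vec := fun j => (a j).1
    fn := fun k => (a k).2
    bound := ‖F‖
    norm_vec_le := fun j => (ha j).1
    norm_fn_le := fun k => (ha k).2.1
    gap := d / 2
    gap_pos := half_pos hd0
    gap_lt := fun k j hkj => by
      rcases hkj.eq_or_lt with rfl | hlt
      · exact (ha k).2.2.2
      · exact (har k j hlt).2
    eq_zero := fun k j hjk => (har j k hjk).1 }⟩

end James

/-! ### Norms and duality of ultraproducts -/

section Ultraproduct

theorem Ultrafilter.tendsto_limUnder_of_norm_le {ι : Type*} (𝒰 : Ultrafilter ι) {a : ι → ℝ} {C : ℝ}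
    (h : ∀ i, ‖a i‖ ≤ C) : Tendsto a 𝒰 (𝓝 (limUnder (𝒰 : Filter ι) a)) := by
  have hK : ∀ᶠ i in (𝒰 : Filter ι), a i ∈ Metric.closedBall (0 : ℝ) C :=
    Eventually.of_forall fun i => by simpa using h i
  obtain ⟨l, -, hl⟩ := (isCompact_closedBall (0 : ℝ) C).ultrafilter_le_nhds (𝒰.map a)
    (le_principal_iff.2 hK)
  exact tendsto_nhds_limUnder ⟨l, hl⟩

/-- The bounded family with prescribed members. -/
noncomputable def lp.ofBounded {ι : Type*} {X : ι → Type*} [∀ i, NormedAddCommGroup (X i)]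
    (x : ∀ i, X i) (C : ℝ) (h : ∀ i, ‖x i‖ ≤ C) : lp X ∞ :=
  ⟨x, memℓp_infty ⟨C, by rintro _ ⟨i, rfl⟩; exact h i⟩⟩

@[simp] theorem lp.ofBounded_apply {ι : Type*} {X : ι → Type*} [∀ i, NormedAddCommGroup (X i)]
    (x : ∀ i, X i) (C : ℝ) (h : ∀ i, ‖x i‖ ≤ C) (i : ι) :
    lp.ofBounded x C h i = x i := rfl

variable {ι : Type w} (𝒰 : Ultrafilter ι) {X : ι → Type u}
  [∀ i, NormedAddCommGroup (X i)] [∀ i, NormedSpace ℝ (X i)]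

/-- A class has a representing family whose members are bounded by any number exceeding its
norm. -/
theorem exists_ultraClass_eq (q : BanachUltraproduct 𝒰 X) {C : ℝ} (hC : ‖q‖ < C) :
    ∃ x : lp X ∞, ultraClass 𝒰 x = q ∧ ∀ i, ‖x i‖ ≤ C := by
  obtain ⟨m, hm, hmn⟩ := Submodule.Quotient.norm_mk_lt q (sub_pos.2 hC)
  exact ⟨m, hm, fun i => (lp.norm_apply_le_norm ENNReal.top_ne_zero m i).trans (by linarith)⟩

/-- The norm of a class in the ultraproduct is the limit of the norms along the ultrafilter. -/
theorem tendsto_norm_ultraClass (x : lp X ∞) :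
    Tendsto (fun i => ‖x i‖) 𝒰 (𝓝 ‖ultraClass 𝒰 x‖) := by
  classical
  have hlim := 𝒰.tendsto_limUnder_of_norm_le (a := fun i => ‖x i‖) (C := ‖x‖)
    fun i => by simpa using lp.norm_apply_le_norm ENNReal.top_ne_zero x i
  set L := limUnder (𝒰 : Filter ι) fun i => ‖x i‖
  have hL0 : 0 ≤ L := ge_of_tendsto' hlim fun i => norm_nonneg _
  suffices ‖ultraClass 𝒰 x‖ = L by rwa [this]
  refine le_antisymm (le_of_forall_pos_le_add fun ε hε => ?_)
    (le_of_forall_pos_le_add fun ε hε => ?_)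
  · have hev : ∀ᶠ i in (𝒰 : Filter ι), ‖x i‖ < L + ε := hlim.eventually_lt_const (by linarith)
    -- Truncating off a set of 𝒰 keeps the class and lowers the supremum norm to L + ε.
    let y : lp X ∞ := lp.ofBounded (fun i => if ‖x i‖ < L + ε then x i else 0) (L + ε) fun i => by
      split_ifs with h
      · exact h.le
      · simpa using by linarith
    have hxy : ultraClass 𝒰 x = ultraClass 𝒰 y := by
      refine (Submodule.Quotient.eq _).2 ?_
      refine (tendsto_congr' ?_).2 tendsto_const_nhds
      filter_upwards [hev] with i hi
      simp [y, hi]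
    rw [hxy]
    refine (Submodule.Quotient.norm_mk_le _ y).trans ?_
    refine lp.norm_le_of_forall_le (by linarith) fun i => ?_
    simp only [y, lp.ofBounded_apply]
    split_ifs with h
    · exact h.le
    · simpa using by linarith
  · obtain ⟨m, hm, hmn⟩ := exists_ultraClass_eq 𝒰 (ultraClass 𝒰 x) (lt_add_of_pos_right _ hε)
    have hnull : Tendsto (fun i => ‖(m - x) i‖) 𝒰 (𝓝 0) :=
      (Submodule.Quotient.eq (nullFamilies 𝒰 X)).1 hm
    rw [← add_zero (‖ultraClass 𝒰 x‖ + ε)]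
    refine le_of_tendsto_of_tendsto' hlim (tendsto_const_nhds.add hnull) fun i => ?_
    have h1 : ‖x i‖ ≤ ‖m i‖ + ‖m i - x i‖ := by
        simpa using norm_sub_le (m i) (m i - x i)
    exact h1.trans (by simpa using hmn i)

theorem tendsto_limUnder_dual_apply (g : lp (fun i => StrongDual ℝ (X i)) ∞) (x : lp X ∞) :
    Tendsto (fun i => g i (x i)) 𝒰 (𝓝 (limUnder (𝒰 : Filter ι) fun i => g i (x i))) :=
  𝒰.tendsto_limUnder_of_norm_le (C := ‖g‖ * ‖x‖) fun i =>
    ((g i).le_opNorm (x i)).trans (mul_le_mul (lp.norm_apply_le_norm ENNReal.top_ne_zero g i)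
      (lp.norm_apply_le_norm ENNReal.top_ne_zero x i) (norm_nonneg _) (norm_nonneg _))

/-- The pairing of a bounded family of functionals with a bounded family of vectors. -/
noncomputable def ultraPairing :
    lp (fun i => StrongDual ℝ (X i)) ∞ →ₗ[ℝ] lp X ∞ →ₗ[ℝ] ℝ :=
  LinearMap.mk₂ ℝ (fun g x => limUnder (𝒰 : Filter ι) fun i => g i (x i))
    (fun g h x => ((tendsto_limUnder_dual_apply 𝒰 g x).add
      (tendsto_limUnder_dual_apply 𝒰 h x)).limUnder_eq)
    (fun c g x => ((tendsto_limUnder_dual_apply 𝒰 g x).const_mul c).limUnder_eq)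
    (fun g x y => by
      simpa using ((tendsto_limUnder_dual_apply 𝒰 g x).add
        (tendsto_limUnder_dual_apply 𝒰 g y)).limUnder_eq)
    (fun c g x => by
      simpa using ((tendsto_limUnder_dual_apply 𝒰 g x).const_mul c).limUnder_eq)

theorem tendsto_ultraPairing (g : lp (fun i => StrongDual ℝ (X i)) ∞) (x : lp X ∞) :
    Tendsto (fun i => g i (x i)) 𝒰 (𝓝 (ultraPairing 𝒰 g x)) :=
  tendsto_limUnder_dual_apply 𝒰 g x

theorem norm_ultraPairing_le (g : lp (fun i => StrongDual ℝ (X i)) ∞) (x : lp X ∞) :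
    ‖ultraPairing 𝒰 g x‖ ≤ ‖ultraClass 𝒰 g‖ * ‖ultraClass 𝒰 x‖ :=
  le_of_tendsto_of_tendsto' (tendsto_ultraPairing 𝒰 g x).norm
    ((tendsto_norm_ultraClass 𝒰 g).mul (tendsto_norm_ultraClass 𝒰 x))
    fun i => (g i).le_opNorm (x i)

theorem norm_ultraClass_eq_zero {x : lp X ∞} (hx : x ∈ nullFamilies 𝒰 X) :
    ‖ultraClass 𝒰 x‖ = 0 :=
  tendsto_nhds_unique (tendsto_norm_ultraClass 𝒰 x) hx

/-- The functional on the ultraproduct induced by a bounded family of functionals. -/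
noncomputable def ultraFunctional (g : lp (fun i => StrongDual ℝ (X i)) ∞) :
    StrongDual ℝ (BanachUltraproduct 𝒰 X) :=
  LinearMap.mkContinuous
    ((nullFamilies 𝒰 X).liftQ (ultraPairing 𝒰 g) fun x hx => by
      have := norm_ultraPairing_le 𝒰 g x
      rw [norm_ultraClass_eq_zero 𝒰 hx, mul_zero] at this
      exact norm_le_zero_iff.1 this)
    ‖ultraClass 𝒰 g‖ fun q => by
      obtain ⟨x, rfl⟩ := Submodule.Quotient.mk_surjective _ q
      exact norm_ultraPairing_le 𝒰 g x

@[simp] theorem ultraFunctional_ultraClass (g : lp (fun i => StrongDual ℝ (X i)) ∞) (x : lp X ∞) :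
    ultraFunctional 𝒰 g (ultraClass 𝒰 x) = ultraPairing 𝒰 g x := rfl

/-- Almost norming vectors, chosen in each coordinate, form one bounded family that almost norms the
functional. -/
theorem norm_ultraFunctional (g : lp (fun i => StrongDual ℝ (X i)) ∞) :
    ‖ultraFunctional 𝒰 g‖ = ‖ultraClass 𝒰 g‖ := by
  refine le_antisymm (LinearMap.mkContinuous_norm_le _ (norm_nonneg _) _)
    (le_of_forall_pos_le_add fun ε hε => ?_)
  have hx : ∀ i, ∃ x : X i, ‖x‖ ≤ 1 ∧ ‖g i‖ - ε ≤ g i x := by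
    intro i
    by_contra! hcon
    have := StrongDual.norm_le_of_forall_apply_le (g := g i) fun x hx => (hcon x hx).le
    linarith
  choose x hx1 hxg using hx
  let y : lp X ∞ := lp.ofBounded x 1 hx1
  have hy : ‖ultraClass 𝒰 y‖ ≤ 1 := le_of_tendsto' (tendsto_norm_ultraClass 𝒰 y) hx1
  have h1 : ‖ultraClass 𝒰 g‖ - ε ≤ ultraPairing 𝒰 g y :=
    le_of_tendsto_of_tendsto' ((tendsto_norm_ultraClass 𝒰 g).sub_const ε)
      (tendsto_ultraPairing 𝒰 g y) hxg
  have h2 := (le_abs_self _).trans ((ultraFunctional 𝒰 g).unit_le_opNorm _ hy)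
  rw [ultraFunctional_ultraClass] at h2
  linarith

/-- The canonical map from the ultraproduct of the duals to the dual of the ultraproduct. -/
noncomputable def ultraDualMap :
    BanachUltraproduct 𝒰 (fun i => StrongDual ℝ (X i)) →ₗ[ℝ]
      StrongDual ℝ (BanachUltraproduct 𝒰 X) :=
  (nullFamilies 𝒰 (fun i => StrongDual ℝ (X i))).liftQ
    { toFun := ultraFunctional 𝒰
      map_add' := fun g h => by
        ext q
        obtain ⟨x, rfl⟩ := Submodule.Quotient.mk_surjective _ q
        exact LinearMap.congr_fun (map_add (ultraPairing 𝒰) g h) x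
      map_smul' := fun c g => by
        ext q
        obtain ⟨x, rfl⟩ := Submodule.Quotient.mk_surjective _ q
        exact LinearMap.congr_fun (map_smul (ultraPairing 𝒰) c g) x }
    fun g hg => by
      have := norm_ultraFunctional 𝒰 g
      rw [norm_ultraClass_eq_zero 𝒰 hg] at this
      ext q
      simpa [this] using (ultraFunctional 𝒰 g).le_opNorm q

theorem norm_ultraDualMap (q : BanachUltraproduct 𝒰 (fun i => StrongDual ℝ (X i))) :
    ‖ultraDualMap 𝒰 q‖ = ‖q‖ := by
  obtain ⟨g, rfl⟩ := Submodule.Quotient.mk_surjective _ q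
  exact norm_ultraFunctional 𝒰 g

theorem ultraDualMap_injective : Function.Injective (ultraDualMap 𝒰 (X := X)) := by
  rw [injective_iff_map_eq_zero]
  intro q hq
  have h := norm_ultraDualMap 𝒰 q
  obtain ⟨g, rfl⟩ := Submodule.Quotient.mk_surjective _ q
  rw [hq, ContinuousLinearMap.opNorm_zero] at h
  refine (Submodule.Quotient.mk_eq_zero _).2 ?_
  have := tendsto_norm_ultraClass 𝒰 g
  rwa [show ‖ultraClass 𝒰 g‖ = 0 from h.symm] at this

/-- The functionals in the range of `ultraDualMap` norm the ultraproduct. -/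
theorem norm_eq_zero_of_forall_ultraFunctional_eq_zero {q : BanachUltraproduct 𝒰 X}
    (h : ∀ g, ultraFunctional 𝒰 g q = 0) : ‖q‖ = 0 := by
  obtain ⟨x, rfl⟩ := Submodule.Quotient.mk_surjective _ q
  choose g hg1 hgx using fun i => exists_dual_vector'' ℝ (x i)
  have hlim := tendsto_ultraPairing 𝒰 (lp.ofBounded g 1 hg1) x
  rw [show ultraPairing 𝒰 (lp.ofBounded g 1 hg1) x = 0 from h _] at hlim
  refine tendsto_nhds_unique (tendsto_norm_ultraClass 𝒰 x) (hlim.congr fun i => ?_)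
  simpa using hgx i

/-- If the ultraproduct is reflexive, then its dual is the ultraproduct of the duals. -/
theorem ultraproductDualEq_of_surjective
    (h : Function.Surjective
      (NormedSpace.inclusionInDoubleDual ℝ (BanachUltraproduct 𝒰 X))) :
    UltraproductDualEq 𝒰 X := by
  have hcomplete : IsClosed (LinearMap.range (ultraDualMap 𝒰 (X := X)) :
      Set (StrongDual ℝ (BanachUltraproduct 𝒰 X))) := by
    let J : BanachUltraproduct 𝒰 (fun i => StrongDual ℝ (X i)) →ₗᵢ[ℝ]
      StrongDual ℝ (BanachUltraproduct 𝒰 X) := ⟨ultraDualMap 𝒰, norm_ultraDualMap 𝒰⟩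
    exact J.isometry.isUniformInducing.isComplete_range.isClosed
  have hsurj : Function.Surjective (ultraDualMap 𝒰 (X := X)) := by
    intro φ
    by_contra hφ
    obtain ⟨F, u, hFu, huF⟩ := geometric_hahn_banach_closed_point
      (LinearMap.range (ultraDualMap 𝒰 (X := X))).convex hcomplete
      (x := φ) (fun ⟨q, hq⟩ => hφ ⟨q, hq⟩)
    have hu : 0 < u := by simpa using hFu 0 (Submodule.zero_mem _)
    -- A functional bounded above on a subspace vanishes there.
    have hF0 : ∀ q, F (ultraDualMap 𝒰 q) = 0 := by
      intro q
      by_contra hne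
      have := hFu _ (LinearMap.mem_range_self (ultraDualMap 𝒰) ((u / F (ultraDualMap 𝒰 q)) • q))
      rw [map_smul, map_smul, smul_eq_mul, div_mul_cancel₀ _ hne] at this
      exact lt_irrefl _ this
    obtain ⟨y, rfl⟩ := h F
    have hy : ‖y‖ = 0 :=
      norm_eq_zero_of_forall_ultraFunctional_eq_zero 𝒰 fun g => hF0 (ultraClass 𝒰 g)
    have := φ.le_opNorm y
    rw [hy, mul_zero, norm_le_zero_iff] at this
    rw [NormedSpace.dual_def, this] at huF
    linarith
  exact ⟨⟨LinearEquiv.ofBijective (ultraDualMap 𝒰) ⟨ultraDualMap_injective 𝒰, hsurj⟩,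
    norm_ultraDualMap 𝒰⟩, fun g x => tendsto_ultraPairing 𝒰 g x⟩

end Ultraproduct

/-! ### Accessibility, reflexivity and super-reflexivity -/

section Accessible

/-- Overspill: properties that hold eventually at each finite index hold eventually at some index
tending to infinity. -/
theorem Ultrafilter.exists_tendsto_atTop_eventually {𝒰 : Ultrafilter ℕ}
    (h𝒰 : (𝒰 : Filter ℕ) ≤ cofinite) {P : ℕ → ℕ → Prop}
    (hP : ∀ j, ∀ᶠ n in (𝒰 : Filter ℕ), P j n) :
    ∃ N : ℕ → ℕ, Tendsto N 𝒰 atTop ∧ ∀ᶠ n in (𝒰 : Filter ℕ), P (N n) n := by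
  classical
  -- The search bound n tends to infinity since 𝒰 is free; the default value 0 is harmless because P
  -- 0 holds eventually.
  let N : ℕ → ℕ := fun n => Nat.findGreatest (fun j => ∀ i ≤ j, P i n) n
  refine ⟨N, tendsto_atTop.2 fun k => ?_, ?_⟩
  · have hk : ∀ᶠ n in (𝒰 : Filter ℕ), k ≤ n :=
      (eventually_ge_atTop k).filter_mono (h𝒰.trans_eq Nat.cofinite_eq_atTop)
    have hall : ∀ᶠ n in (𝒰 : Filter ℕ), ∀ i ∈ Set.Iic k, P i n :=
      (eventually_all_finite (Set.finite_Iic k)).2 fun i _ => hP i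
    filter_upwards [hk, hall] with n hn hPn
    exact Nat.le_findGreatest hn hPn
  · filter_upwards [hP 0] with n hn
    exact Nat.findGreatest_spec (P := fun j => ∀ i ≤ j, P i n) (Nat.zero_le n)
      (fun i hi => by rwa [Nat.le_zero.1 hi]) _ le_rfl

/-- Functionals in the dual ball have a weak-* limit along any ultrafilter. -/
theorem exists_dual_tendsto_apply {Y : Type*} [SeminormedAddCommGroup Y] [NormedSpace ℝ Y]
    (𝒱 : Ultrafilter ℕ) {f : ℕ → StrongDual ℝ Y} (hf : ∀ k, ‖f k‖ ≤ 1) :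
    ∃ φ : StrongDual ℝ Y, ∀ y, Tendsto (fun k => f k y) 𝒱 (𝓝 (φ y)) := by
  have hK : ∀ᶠ k in (𝒱 : Filter ℕ), StrongDual.toWeakDual (f k) ∈
      WeakDual.toStrongDual ⁻¹' Metric.closedBall (0 : StrongDual ℝ Y) 1 :=
    Eventually.of_forall fun k => by simpa using hf k
  obtain ⟨φ, -, hφ⟩ := (WeakDual.isCompact_closedBall (0 : StrongDual ℝ Y) 1).ultrafilter_le_nhds
    (𝒱.map fun k => StrongDual.toWeakDual (f k)) (le_principal_iff.2 hK)
  exact ⟨WeakDual.toStrongDual φ, fun y => ((WeakDual.eval_continuous y).tendsto φ).comp hφ⟩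

variable {𝒰 : Ultrafilter ℕ} {X : ℕ → Type u}
  [∀ n, NormedAddCommGroup (X n)] [∀ n, NormedSpace ℝ (X n)]

/-- If all functionals on an ultraproduct are accessible, then it contains no James sequence. -/
theorem isEmpty_jamesSequence_of_isAccessible (h𝒰 : (𝒰 : Filter ℕ) ≤ cofinite)
    (hacc : ∀ φ : StrongDual ℝ (BanachUltraproduct 𝒰 X), IsAccessible φ) :
    IsEmpty (JamesSequence (BanachUltraproduct 𝒰 X)) := by
  refine ⟨fun S => ?_⟩
  choose x hx hxC using fun j => exists_ultraClass_eq 𝒰 (S.vec j) (C := S.bound + 1)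
    ((S.norm_vec_le j).trans_lt (lt_add_one _))
  obtain ⟨φ, hφ⟩ := exists_dual_tendsto_apply (hyperfilter ℕ) S.norm_fn_le
  have htop : ((hyperfilter ℕ : Ultrafilter ℕ) : Filter ℕ) ≤ atTop :=
    (hyperfilter_le_cofinite).trans_eq Nat.cofinite_eq_atTop
  have hφ0 : ∀ j, φ (S.vec j) = 0 := fun j =>
    tendsto_nhds_unique (hφ (S.vec j)) <| (tendsto_congr'
      (((eventually_gt_atTop j).filter_mono htop).mono fun k hk => S.eq_zero k j hk)).2
      tendsto_const_nhds
  obtain ⟨a, ha⟩ := hacc φ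
  choose b hb using fun k => hacc (S.fn k)
  obtain ⟨N, hN, hPN⟩ := Ultrafilter.exists_tendsto_atTop_eventually h𝒰
    (P := fun j n => a n (x j n) < S.gap / 2 ∧ ∀ k ∈ Set.Iic j, S.gap < b k n (x j n)) (by
      intro j
      refine Eventually.and ?_ ((eventually_all_finite (Set.finite_Iic j)).2 fun k hk => ?_)
      · refine (ha (x j)).eventually_lt_const ?_
        rw [hx, hφ0]
        exact half_pos S.gap_pos
      · refine (hb k (x j)).eventually_const_lt ?_
        rw [hx]
        exact S.gap_lt k j hk)
  let z : lp X ∞ := lp.ofBounded (fun n => x (N n) n) (S.bound + 1) fun n => hxC (N n) n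
  have hle : φ (ultraClass 𝒰 z) ≤ S.gap / 2 :=
    le_of_tendsto (ha z) (hPN.mono fun n hn => hn.1.le)
  have hge : S.gap ≤ φ (ultraClass 𝒰 z) := by
    refine ge_of_tendsto' (hφ (ultraClass 𝒰 z)) fun k => ge_of_tendsto (hb k z) ?_
    filter_upwards [hPN, hN.eventually_ge_atTop k] with n hn hk
    exact (hn.2 k hk).le
  linarith [S.gap_pos]

/-- If all functionals on an ultraproduct of complete spaces are accessible, then it is
reflexive. -/
theorem surjective_inclusionInDoubleDual_of_isAccessible [∀ n, CompleteSpace (X n)]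
    (h𝒰 : (𝒰 : Filter ℕ) ≤ cofinite)
    (hacc : ∀ φ : StrongDual ℝ (BanachUltraproduct 𝒰 X), IsAccessible φ) :
    Function.Surjective (NormedSpace.inclusionInDoubleDual ℝ (BanachUltraproduct 𝒰 X)) := by
  by_contra h
  obtain ⟨S⟩ := nonempty_jamesSequence_of_not_surjective h
  exact (isEmpty_jamesSequence_of_isAccessible h𝒰 hacc).false S

/-- A functional on the domain of an expansive linear map is transported to the codomain without
increasing its norm. -/
theorem exists_dual_apply_eq_of_norm_le {E : Type*} [NormedAddCommGroup E] [NormedSpace ℝ E]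
    {X : Type*} [NormedAddCommGroup X] [NormedSpace ℝ X] (T : E →ₗ[ℝ] X)
    (hT : ∀ y, ‖y‖ ≤ ‖T y‖) (f : StrongDual ℝ E) :
    ∃ g : StrongDual ℝ X, ‖g‖ ≤ ‖f‖ ∧ ∀ y, g (T y) = f y := by
  have hinj : Function.Injective T := by
    rw [injective_iff_map_eq_zero]
    intro y hy
    simpa [hy] using hT y
  let e := LinearEquiv.ofInjective T hinj
  let f' : StrongDual ℝ (LinearMap.range T) :=
    (f.toLinearMap ∘ₗ e.symm.toLinearMap).mkContinuous ‖f‖ fun z => by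
      obtain ⟨y, rfl⟩ := e.surjective z
      simpa [e] using (f.le_opNorm y).trans (mul_le_mul_of_nonneg_left (hT y) (norm_nonneg f))
  obtain ⟨g, hg, hgn⟩ := exists_extension_norm_eq _ f'
  refine ⟨g, hgn.trans_le (LinearMap.mkContinuous_norm_le _ (norm_nonneg f) _), fun y => ?_⟩
  have := hg (e y)
  simpa [f', e] using this

/-- James sequences pass from a space that is finitely representable in `X` to the ultrapowers
of `X`. -/
theorem FinitelyRepresentable.nonempty_jamesSequence {Z : Type*} [NormedAddCommGroup Z]
    [NormedSpace ℝ Z] {X : Type*} [NormedAddCommGroup X] [NormedSpace ℝ X]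
    (h : FinitelyRepresentable Z X) (h𝒰 : (𝒰 : Filter ℕ) ≤ cofinite) (S : JamesSequence Z) :
    Nonempty (JamesSequence (BanachUltraproduct 𝒰 fun _ : ℕ => X)) := by
  let E : ℕ → Submodule ℝ Z := fun n => Submodule.span ℝ (S.vec '' Set.Iic n)
  have hE : ∀ n, FiniteDimensional ℝ (E n) := fun n =>
    FiniteDimensional.span_of_finite ℝ ((Set.finite_Iic n).image _)
  -- Any fixed distortion would do; ε = 1 gives the bound 2 * `S.bound` below.
  choose T hT using fun n => h (E n) (hE n) 1 one_pos
  have hmem : ∀ {j n}, j ≤ n → S.vec j ∈ E n := fun hjn =>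
    Submodule.subset_span ⟨_, hjn, rfl⟩
  choose g hg hgT using fun n k =>
    exists_dual_apply_eq_of_norm_le (T n) (fun y => (hT n y).1) ((S.fn k).comp (E n).subtypeL)
  have hg1 : ∀ k n, ‖g n k‖ ≤ 1 := fun k n => by
    refine (hg n k).trans ((ContinuousLinearMap.opNorm_comp_le _ _).trans ?_)
    exact mul_le_one₀ (S.norm_fn_le k) (norm_nonneg _) (Submodule.norm_subtypeL_le _)
  have hb0 : 0 ≤ S.bound := (norm_nonneg _).trans (S.norm_vec_le 0)
  -- The value 0 occurs only for the finitely many n < j, which 𝒰 ignores.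
  let x : ℕ → ℕ → X := fun j n => if hjn : j ≤ n then T n ⟨S.vec j, hmem hjn⟩ else 0
  have hx : ∀ j n, ‖x j n‖ ≤ 2 * S.bound := fun j n => by
    by_cases hjn : j ≤ n
    · simp only [x, dif_pos hjn]
      refine (hT n _).2.trans ?_
      have := S.norm_vec_le j
      simp only [Submodule.coe_norm]
      linarith
    · simpa [x, dif_neg hjn] using hb0
  let vec : ℕ → lp (fun _ : ℕ => X) ∞ := fun j => lp.ofBounded (x j) _ (hx j)
  let fn : ℕ → lp (fun _ : ℕ => StrongDual ℝ X) ∞ := fun k =>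
    lp.ofBounded (fun n => g n k) 1 (hg1 k)
  have hval : ∀ k j, ultraFunctional 𝒰 (fn k) (ultraClass 𝒰 (vec j)) = S.fn k (S.vec j) := by
    intro k j
    refine tendsto_nhds_unique (tendsto_ultraPairing 𝒰 (fn k) (vec j))
      ((tendsto_congr' ?_).2 tendsto_const_nhds)
    filter_upwards [(eventually_ge_atTop j).filter_mono (h𝒰.trans_eq Nat.cofinite_eq_atTop)]
      with n hn
    simp [fn, vec, x, dif_pos hn, hgT]
  exact ⟨{
    vec := fun j => ultraClass 𝒰 (vec j)
    fn := fun k => ultraFunctional 𝒰 (fn k)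
    bound := 2 * S.bound
    norm_vec_le := fun j => le_of_tendsto' (tendsto_norm_ultraClass 𝒰 (vec j)) (hx j)
    norm_fn_le := fun k => by
      rw [norm_ultraFunctional]
      exact le_of_tendsto' (tendsto_norm_ultraClass 𝒰 (fn k)) (hg1 k)
    gap := S.gap
    gap_pos := S.gap_pos
    gap_lt := fun k j hkj => by
      rw [hval]
      exact S.gap_lt k j hkj
    eq_zero := fun k j hjk => by
      rw [hval]
      exact S.eq_zero k j hjk }⟩

theorem isSuperReflexive_of_isAccessible {X : Type v} [NormedAddCommGroup X] [NormedSpace ℝ X]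
    (h𝒰 : (𝒰 : Filter ℕ) ≤ cofinite)
    (hacc : ∀ φ : StrongDual ℝ (BanachUltraproduct 𝒰 fun _ : ℕ => X), IsAccessible φ) :
    IsSuperReflexive.{v, w} X := by
  intro Z _ _ _ hZ
  by_contra h
  obtain ⟨S⟩ := nonempty_jamesSequence_of_not_surjective h
  obtain ⟨S'⟩ := hZ.nonempty_jamesSequence h𝒰 S
  exact (isEmpty_jamesSequence_of_isAccessible h𝒰 hacc).false S'

/-- A non-free ultrafilter is principal, hence closed under countable intersections. -/
theorem Ultrafilter.le_cofinite_of_not_countableInterFilter {ι : Type*} {𝒰 : Ultrafilter ι}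
    (h : ¬ CountableInterFilter (𝒰 : Filter ι)) : (𝒰 : Filter ι) ≤ cofinite := by
  rcases 𝒰.le_cofinite_or_eq_pure with h' | ⟨a, rfl⟩
  · exact h'
  · exact absurd ⟨fun S _ hS => by simpa using hS⟩ h

end Accessible

theorem mainTheorem10 :
    (∀ 𝒰 : Ultrafilter ℕ, (𝒰 : Filter ℕ) ≤ cofinite →
      ∀ (X : ℕ → Type u) [∀ n, NormedAddCommGroup (X n)] [∀ n, NormedSpace ℝ (X n)]
        [∀ n, FiniteDimensional ℝ (X n)],
        (∀ φ : StrongDual ℝ (BanachUltraproduct 𝒰 X), IsAccessible φ) →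
          UltraproductDualEq 𝒰 X) ∧
    (∀ 𝒰 : Ultrafilter ℕ, ¬ CountableInterFilter (𝒰 : Filter ℕ) →
      ∀ (X : Type v) [NormedAddCommGroup X] [NormedSpace ℝ X] [CompleteSpace X],
        (FiniteDimensional ℝ X ∨ Nonempty (SchauderBasis ℝ X)) →
        (∀ φ : StrongDual ℝ (BanachUltraproduct 𝒰 (fun _ : ℕ => X)), IsAccessible φ) →
          IsSuperReflexive.{v, w} X ∧ UltraproductDualEq 𝒰 (fun _ : ℕ => X)) := by
  refine ⟨fun 𝒰 h𝒰 X _ _ _ hacc => ?_, fun 𝒰 h𝒰 X _ _ _ _ hacc => ?_⟩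
  · have : ∀ n, CompleteSpace (X n) := fun n => FiniteDimensional.complete ℝ (X n)
    exact ultraproductDualEq_of_surjective 𝒰
      (surjective_inclusionInDoubleDual_of_isAccessible h𝒰 hacc)
  · have hfree := Ultrafilter.le_cofinite_of_not_countableInterFilter h𝒰
    exact ⟨isSuperReflexive_of_isAccessible hfree hacc, ultraproductDualEq_of_surjective 𝒰
      (surjective_inclusionInDoubleDual_of_isAccessible hfree hacc)⟩
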